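/- **Proposition (Hardy-type inequality).** Let $d \ge 2$, let $S^{d-1}$ be the unit sphere of $\mathbb{R}^d$ with its surface measure $d\sigma$, and let $b$ be a non-negative (measurable) function on $[-1,1]$, whose values at $\pm 1$ play no role, such that $$\forall \sigma \in S^{d-1}, \qquad \int_{S^{d-1}} \bigl(1-(\sigma\cdot\sigma')^2\bigr)\, b(\sigma\cdot\sigma')\, d\sigma' < +\infty .$$ Then the number $$C_P = \frac{1}{d-1}\int_{S^{d-1}} \bigl(1-(\sigma'\cdot\sigma)^2\bigr)\, b(\sigma'\cdot\sigma)\, d\sigma'$$ does not depend on $\sigma \in S^{d-1}$, and for every smooth function $F\colon S^{d-1}\to\mathbb{R}$ with $F(-\sigma)=F(\sigma)$ for all $\sigma$, both integrals below are finite and $$\iint_{S^{d-1}\times S^{d-1}} (F(\sigma')-F(\sigma))^2\, b(\sigma'\cdot\sigma)\, d\sigma\, d\sigma' \;\le\; C_P \int_{S^{d-1}} |\nabla_\sigma F|^2\, d\sigma ,$$ where $\nabla_\sigma F$ is the gradient of $F$ on the sphere for the metric induced by $\mathbb{R}^d$. -/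

import Mathlib

open MeasureTheory
open scoped ContDiff Manifold

noncomputable section

/-- The unit sphere `S^{d-1}` of the Euclidean space `ℝ^d`, where `d = n + 1`. -/
abbrev SphereS (n : ℕ) : Type :=
  Metric.sphere (0 : EuclideanSpace ℝ (Fin (n + 1))) 1

/-- The surface measure `dσ` on the sphere: the mass of a set `s` is `d` times the Lebesgue measure
of the cone `{r σ : 0 < r < 1, σ ∈ s}`. -/
def surfaceMeasure (n : ℕ) : Measure (SphereS n) :=
  (volume : Measure (EuclideanSpace ℝ (Fin (n + 1)))).toSphere

/-- The scalar product `σ · σ'` in `ℝ^d` of two points of the sphere. -/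
def sdot {n : ℕ} (σ σ' : SphereS n) : ℝ :=
  inner ℝ (σ : EuclideanSpace ℝ (Fin (n + 1))) (σ' : EuclideanSpace ℝ (Fin (n + 1)))

/-- The extension of `F` that is constant along rays, `x ↦ F (x / |x|)` for `x ≠ 0`
(and `0` at the origin). -/
def radialExtension {n : ℕ} (F : SphereS n → ℝ) (x : EuclideanSpace ℝ (Fin (n + 1))) : ℝ :=
  Function.extend (Subtype.val : SphereS n → EuclideanSpace ℝ (Fin (n + 1))) F 0 (‖x‖⁻¹ • x)

/-- The gradient `∇_σ F` on the sphere (for the metric induced by `ℝ^d`), as a vector of `ℝ^d`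
tangent to the sphere at `σ`: the Euclidean gradient at `σ` of the extension of `F` that is
constant along rays. -/
def sphericalGradient {n : ℕ} (F : SphereS n → ℝ) (σ : SphereS n) :
    EuclideanSpace ℝ (Fin (n + 1)) :=
  gradient (radialExtension F) (σ : EuclideanSpace ℝ (Fin (n + 1)))

/-- The integrability condition on the collision kernel `b`:
`∫ (1 - (σ · σ')²) b (σ · σ') dσ' < ∞` for every `σ` in the sphere. -/
def LevyCondition (n : ℕ) (b : ℝ → ℝ) : Prop :=
  ∀ σ : SphereS n,
    ∫⁻ σ', ENNReal.ofReal ((1 - sdot σ σ' ^ 2) * b (sdot σ σ')) ∂(surfaceMeasure n) < ⊤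

end

/-! The inequality reduces to great circles, where it is a Fourier estimate. Along a great circle an
even function is `π`-periodic, so only the frequencies `2k` occur. A shift by `θ` changes the mode
`k` by a factor of squared modulus `|exp(2ikθ) - 1|² = 4 sin²(kθ) ≤ 4k² sin²θ`, while
differentiation multiplies its squared modulus by `4k²`. Parseval then bounds the squared increment
by `sin²θ` times the squared derivative (`integral_sq_sub_comp_add_right_le`).

Averaging over all rotations of one great circle turns this into a bound for a pair `σ, σ'` at angle
`θ`, where `sin²θ = 1 - (σ·σ')²`. The mean squared derivative in one tangent direction is `1/n` of
the mean of `|∇F|²`, with `n = d - 1`, since all tangent directions are equivalent under rotation.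
This is `integral_sq_sub_sphereRotate_le`, the source of the constant `1/(d-1)`.

The kernel and the product of surface measures are rotation invariant, so the double integral may be
averaged over rotations before this bound is inserted (`lintegral_sq_sub_mul_le`). Working in
`ENNReal` makes finiteness part of the conclusion. -/

/-! ### Fourier series of period `π` and the inequality on a circle. -/

theorem Real.abs_sin_natCast_mul_le (k : ℕ) (θ : ℝ) : |Real.sin (k * θ)| ≤ k * |Real.sin θ| := by
  induction k with
  | zero => simp
  | succ k ih =>
    have h : ((k + 1 : ℕ) : ℝ) * θ = k * θ + θ := by push_cast; ring
    rw [h, Real.sin_add]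
    calc _ ≤ |Real.sin (k * θ) * Real.cos θ| + |Real.cos (k * θ) * Real.sin θ| := abs_add_le _ _
      _ ≤ k * |Real.sin θ| * 1 + 1 * |Real.sin θ| := by
        rw [abs_mul, abs_mul]
        gcongr
        · exact Real.abs_cos_le_one θ
        · exact Real.abs_cos_le_one _
      _ = _ := by push_cast; ring

theorem Real.sin_intCast_mul_sq_le (k : ℤ) (θ : ℝ) :
    Real.sin (k * θ) ^ 2 ≤ (k : ℝ) ^ 2 * Real.sin θ ^ 2 := by
  have h : Real.sin (k * θ) ^ 2 = Real.sin (k.natAbs * θ) ^ 2 := by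
    rcases Int.natAbs_eq k with h | h
    · conv_lhs => rw [h]
      simp
    · conv_lhs => rw [h]
      simp
  have h2 : (k : ℝ) ^ 2 = (k.natAbs : ℝ) ^ 2 := by
    rw [Nat.cast_natAbs]; push_cast; rw [sq_abs]
  rw [h, h2, ← mul_pow, sq_le_sq, abs_mul (k.natAbs : ℝ), Nat.abs_cast]
  exact Real.abs_sin_natCast_mul_le _ θ

theorem Complex.norm_exp_mul_I_sub_one_sq (x : ℝ) :
    ‖Complex.exp (2 * x * Complex.I) - 1‖ ^ 2 = 4 * Real.sin x ^ 2 := by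
  have h := Complex.norm_exp_I_mul_ofReal_sub_one (2 * x)
  rw [show 2 * (x : ℂ) * Complex.I = Complex.I * ((2 * x : ℝ) : ℂ) by push_cast; ring, h]
  rw [show 2 * x / 2 = x by ring, Real.norm_eq_abs, sq_abs]
  ring

/-- The Fourier coefficients on `[0, π]` as explicit integrals. -/
theorem fourierCoeffOn_pi_eq (f : ℝ → ℂ) (k : ℤ) :
    fourierCoeffOn Real.pi_pos f k =
      (1 / Real.pi : ℝ) • ∫ x in (0 : ℝ)..Real.pi, Complex.exp (-(2 * k * x) * Complex.I) * f x := by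
  rw [fourierCoeffOn_eq_integral]
  simp only [fourier_coe_apply, smul_eq_mul]
  rw [sub_zero]
  congr 1
  refine intervalIntegral.integral_congr fun x _ => ?_
  have : (Real.pi : ℂ) ≠ 0 := by exact_mod_cast Real.pi_ne_zero
  congr 2
  push_cast
  field_simp

theorem fourierCoeffOn_pi_comp_add_right {f : ℝ → ℂ} (hf : Function.Periodic f Real.pi)
    (θ : ℝ) (k : ℤ) :
    fourierCoeffOn Real.pi_pos (fun x => f (x + θ)) k =
      Complex.exp (2 * (k * θ : ℝ) * Complex.I) * fourierCoeffOn Real.pi_pos f k := by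
  rw [fourierCoeffOn_pi_eq, fourierCoeffOn_pi_eq, mul_smul_comm]
  congr 1
  have hper : Function.Periodic
      (fun x : ℝ => Complex.exp (-(2 * k * x) * Complex.I) * f x) Real.pi := by
    intro x
    simp only [hf x]
    congr 1
    rw [Complex.exp_eq_exp_iff_exists_int]
    exact ⟨-k, by push_cast; ring⟩
  rw [← intervalIntegral.integral_const_mul]
  have h1 : ∀ x : ℝ, Complex.exp (-(2 * k * x) * Complex.I) * f (x + θ) =
      (fun y : ℝ => Complex.exp (2 * (k * θ : ℝ) * Complex.I) *
        (Complex.exp (-(2 * k * y) * Complex.I) * f y)) (x + θ) := by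
    intro x
    simp only
    rw [← mul_assoc, ← Complex.exp_add]
    congr 2
    push_cast
    ring
  simp_rw [h1]
  rw [intervalIntegral.integral_comp_add_right
    (fun y : ℝ => Complex.exp (2 * (k * θ : ℝ) * Complex.I) *
        (Complex.exp (-(2 * k * y) * Complex.I) * f y))]
  rw [intervalIntegral.integral_const_mul, intervalIntegral.integral_const_mul]
  congr 1
  have := hper.intervalIntegral_add_eq θ 0
  rw [zero_add] at this
  rw [zero_add, add_comm Real.pi, this]

theorem fourierCoeffOn_pi_sub {f g : ℝ → ℂ} (hf : Continuous f) (hg : Continuous g) (k : ℤ) :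
    fourierCoeffOn Real.pi_pos (fun x => f x - g x) k =
      fourierCoeffOn Real.pi_pos f k - fourierCoeffOn Real.pi_pos g k := by
  rw [fourierCoeffOn_pi_eq, fourierCoeffOn_pi_eq, fourierCoeffOn_pi_eq, ← smul_sub,
    ← intervalIntegral.integral_sub]
  · simp_rw [mul_sub]
  · exact (by fun_prop : Continuous _).intervalIntegrable _ _
  · exact (by fun_prop : Continuous _).intervalIntegrable _ _

theorem hasSum_sq_fourierCoeffOn_pi {f : ℝ → ℝ} (hf : Continuous f) :
    HasSum (fun k => ‖fourierCoeffOn Real.pi_pos (fun x => (f x : ℂ)) k‖ ^ 2)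
      (Real.pi⁻¹ * ∫ x in (0 : ℝ)..Real.pi, f x ^ 2) := by
  have hL : MemLp (fun x => (f x : ℂ)) 2 (volume.restrict (Set.Ioc 0 Real.pi)) := by
    have hc : Continuous fun x => (f x : ℂ) := by fun_prop
    obtain ⟨C, hC⟩ := (isCompact_Icc (a := (0 : ℝ)) (b := Real.pi)).exists_bound_of_continuousOn
      hc.continuousOn
    refine MemLp.of_bound hc.aestronglyMeasurable C ?_
    filter_upwards [ae_restrict_mem measurableSet_Ioc] with x hx
    exact hC x ⟨hx.1.le, hx.2⟩
  have := hasSum_sq_fourierCoeffOn Real.pi_pos hL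
  simpa using this

/-- Parseval on both sides, compared mode by mode. Period `π` is essential: with period `2π` the
factor would be `4 sin²(θ/2)`, which does not vanish at `θ = π`. -/
theorem integral_sq_sub_comp_add_right_le {f f' : ℝ → ℝ} (hper : Function.Periodic f Real.pi)
    (hd : ∀ x, HasDerivAt f (f' x) x) (hc : Continuous f') (θ : ℝ) :
    ∫ t in (0 : ℝ)..Real.pi, (f (t + θ) - f t) ^ 2 ≤
      Real.sin θ ^ 2 * ∫ t in (0 : ℝ)..Real.pi, f' t ^ 2 := by
  have hfc : Continuous f := continuous_iff_continuousAt.2 fun x => (hd x).continuousAt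
  have h1 := hasSum_sq_fourierCoeffOn_pi (f := fun t => f (t + θ) - f t) (by fun_prop)
  have h2 := (hasSum_sq_fourierCoeffOn_pi hc).mul_left (Real.sin θ ^ 2)
  -- Integration by parts, with boundary term killed by `f π = f 0`. The mode `k = 0` is separate
  -- because the general formula divides by `k`.
  have hcoef : ∀ k : ℤ, fourierCoeffOn Real.pi_pos (fun x => (f' x : ℂ)) k =
      2 * k * Complex.I * fourierCoeffOn Real.pi_pos (fun x => (f x : ℂ)) k := by
    intro k
    have hfpi : f Real.pi = f 0 := by simpa using hper 0
    rcases eq_or_ne k 0 with rfl | hk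
    · rw [fourierCoeffOn_pi_eq]
      have : ∫ x in (0 : ℝ)..Real.pi, f' x = f Real.pi - f 0 :=
        intervalIntegral.integral_eq_sub_of_hasDerivAt (fun x _ => hd x)
          (hc.intervalIntegrable _ _)
      simp [intervalIntegral.integral_ofReal, this, hfpi]
    · have := fourierCoeffOn_of_hasDerivAt Real.pi_pos hk
        (f := fun x => (f x : ℂ)) (f' := fun x => (f' x : ℂ)) (fun x _ => (hd x).ofReal_comp)
        ((by fun_prop : Continuous fun x => (f' x : ℂ)).intervalIntegrable _ _)
      rw [this, hfpi]
      have hp : (Real.pi : ℂ) ≠ 0 := by exact_mod_cast Real.pi_ne_zero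
      have hk' : (k : ℂ) ≠ 0 := by exact_mod_cast hk
      have := Complex.I_ne_zero
      simp
      field_simp
      rw [Complex.I_sq]
      ring
  have hle := hasSum_le (fun k => ?_) h1 h2
  · rw [← mul_assoc, mul_comm _ Real.pi⁻¹, mul_assoc] at hle
    exact le_of_mul_le_mul_left hle (inv_pos.2 Real.pi_pos)
  · have e : fourierCoeffOn Real.pi_pos (fun x => ((f (x + θ) - f x : ℝ) : ℂ)) k =
        (Complex.exp (2 * (k * θ : ℝ) * Complex.I) - 1) *
          fourierCoeffOn Real.pi_pos (fun x => (f x : ℂ)) k := by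
      have hp : Function.Periodic (fun x => (f x : ℂ)) Real.pi := fun x => by simp only [hper x]
      have hs := fourierCoeffOn_pi_comp_add_right hp θ k
      simp_rw [Complex.ofReal_sub]
      rw [fourierCoeffOn_pi_sub (f := fun x => (f (x + θ) : ℂ)) (g := fun x => (f x : ℂ))
        (by fun_prop) (by fun_prop), hs]
      ring
    rw [e, hcoef, norm_mul, norm_mul, mul_pow, mul_pow, Complex.norm_exp_mul_I_sub_one_sq]
    have : ‖2 * (k : ℂ) * Complex.I‖ ^ 2 = 4 * (k : ℝ) ^ 2 := by
      rw [norm_mul, norm_mul, Complex.norm_I, mul_one, mul_pow]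
      simp
      norm_num
    rw [this, ← mul_assoc]
    refine mul_le_mul_of_nonneg_right ?_ (by positivity)
    linarith [Real.sin_intCast_mul_sq_le k θ]

/-! ### The compact orthogonal group, its Haar probability measure and its transitivity. -/

section OrthogonalGroup

variable {E : Type*} [NormedAddCommGroup E] [InnerProductSpace ℝ E] [FiniteDimensional ℝ E]

instance compactSpace_unitary_clm : CompactSpace (unitary (E →L[ℝ] E)) := by
  have : ProperSpace (E →L[ℝ] E) := FiniteDimensional.proper ℝ _
  refine isCompact_iff_compactSpace.1 (Metric.isCompact_of_isClosed_isBounded isClosed_unitary ?_)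
  refine (Metric.isBounded_iff_subset_closedBall 0).2 ⟨1, fun u hu => ?_⟩
  rw [mem_closedBall_zero_iff]
  exact ContinuousLinearMap.opNorm_le_bound _ zero_le_one fun x => by
    rw [one_mul]; exact (Unitary.norm_map ⟨u, hu⟩ x).le

instance secondCountable_unitary_clm : SecondCountableTopology (unitary (E →L[ℝ] E)) := by
  have : ProperSpace (E →L[ℝ] E) := FiniteDimensional.proper ℝ _
  infer_instance

variable (E) in
/-- The right-invariant Haar probability measure of the orthogonal group. -/
noncomputable def orthogonalHaar : Measure (unitary (E →L[ℝ] E)) :=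
  (Measure.haarMeasure (⊤ : TopologicalSpace.PositiveCompacts (unitary (E →L[ℝ] E)))).inv

/-- `haarMeasure` is left invariant and inversion exchanges the two sides. Right invariance is the
one needed: `g ↦ g * k` moves the base vector of `g x` to `k x`. -/
instance : (orthogonalHaar E).IsMulRightInvariant := by
  unfold orthogonalHaar; infer_instance

instance : IsProbabilityMeasure (orthogonalHaar E) := by
  constructor
  rw [orthogonalHaar, Measure.inv_apply, Set.inv_univ]
  exact Measure.haarMeasure_self

/-- The orthogonal group acts transitively on orthonormal pairs. -/
theorem exists_unitary_apply_eq {x y x' y' : E} (hx : ‖x‖ = 1) (hy : ‖y‖ = 1)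
    (hxy : inner ℝ x y = 0) (hx' : ‖x'‖ = 1) (hy' : ‖y'‖ = 1) (hxy' : inner ℝ x' y' = 0) :
    ∃ g : unitary (E →L[ℝ] E), (g : E →L[ℝ] E) x = x' ∧ (g : E →L[ℝ] E) y = y' := by
  have key : ∀ a b : E, ‖a‖ = 1 → ‖b‖ = 1 → inner ℝ a b = 0 →
      ∃ (h : 2 ≤ Module.finrank ℝ E) (B : OrthonormalBasis (Fin (Module.finrank ℝ E)) ℝ E),
        B ⟨0, by omega⟩ = a ∧ B ⟨1, by omega⟩ = b := by
    intro a b ha hb hab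
    have ho : Orthonormal ℝ ![a, b] := by
      rw [orthonormal_iff_ite]
      have hba : inner ℝ b a = 0 := by rw [real_inner_comm]; exact hab
      intro i j
      fin_cases i <;> fin_cases j <;> simp [ha, hb, hab, hba]
    have h2 : 2 ≤ Module.finrank ℝ E := by
      simpa using ho.linearIndependent.fintype_card_le_finrank
    refine ⟨h2, ?_⟩
    -- Only the values at the indices `0` and `1` matter; the others are filler, discarded by
    -- restricting to `s`.
    let v : Fin (Module.finrank ℝ E) → E := fun i => if (i : ℕ) = 0 then a else b
    let s : Set (Fin (Module.finrank ℝ E)) := {i | (i : ℕ) < 2}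
    have hv : Orthonormal ℝ (s.domRestrict v) := by
      have : s.domRestrict v = ![a, b] ∘ fun i : s => (⟨i.1.1, i.2⟩ : Fin 2) := by
        funext i
        obtain ⟨⟨i, hi⟩, his⟩ := i
        simp only [s, Set.mem_ofPred_eq] at his
        interval_cases i <;> simp [v, Set.domRestrict]
      rw [this]
      refine ho.comp _ fun i j hij => ?_
      apply Subtype.ext
      apply Fin.ext
      simpa using hij
    obtain ⟨B, hB⟩ := hv.exists_orthonormalBasis_extension_of_card_eq (by simp)
    refine ⟨B, ?_, ?_⟩
    · rw [hB _ (by simp [s])]; simp [v]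
    · rw [hB _ (by simp [s])]; simp [v]
  obtain ⟨_, B, hB0, hB1⟩ := key x y hx hy hxy
  obtain ⟨_, B', hB0', hB1'⟩ := key x' y' hx' hy' hxy'
  refine ⟨Unitary.linearIsometryEquiv.symm (B.equiv B' (Equiv.refl _)), ?_, ?_⟩
  · rw [← hB0, ← hB0']; simp
  · rw [← hB1, ← hB1']; simp

theorem exists_unitary_apply_eq_of_norm_eq_one {x x' : E} (hE : 2 ≤ Module.finrank ℝ E)
    (hx : ‖x‖ = 1) (hx' : ‖x'‖ = 1) : ∃ g : unitary (E →L[ℝ] E), (g : E →L[ℝ] E) x = x' := by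
  have key : ∀ a : E, ∃ b : E, ‖b‖ = 1 ∧ inner ℝ a b = 0 := by
    intro a
    have : Module.finrank ℝ (ℝ ∙ a) < Module.finrank ℝ E := by
      have := finrank_span_le_card (R := ℝ) ({a} : Set E)
      rw [Set.toFinset_singleton, Finset.card_singleton] at this
      omega
    have hne : (ℝ ∙ a) ≠ ⊤ := fun h => by rw [h, finrank_top] at this; exact lt_irrefl _ this
    have hne' : (ℝ ∙ a)ᗮ ≠ ⊥ := fun h => hne (Submodule.orthogonal_eq_bot_iff.1 h)
    obtain ⟨w, hw, hw0⟩ := Submodule.exists_mem_ne_zero_of_ne_bot hne'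
    refine ⟨‖w‖⁻¹ • w, norm_smul_inv_norm hw0, ?_⟩
    rw [inner_smul_right, Submodule.mem_orthogonal_singleton_iff_inner_right.1 hw, mul_zero]
  obtain ⟨y, hy, hxy⟩ := key x
  obtain ⟨y', hy', hxy'⟩ := key x'
  obtain ⟨g, hg, -⟩ := exists_unitary_apply_eq hx hy hxy hx' hy' hxy'
  exact ⟨g, hg⟩

/-- The average of a function of a moving orthonormal pair does not depend on the pair. -/
theorem integral_orthogonalHaar_pair_eq {x y x' y' : E} (hx : ‖x‖ = 1) (hy : ‖y‖ = 1)
    (hxy : inner ℝ x y = 0) (hx' : ‖x'‖ = 1) (hy' : ‖y'‖ = 1) (hxy' : inner ℝ x' y' = 0)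
    (H : E → E → ℝ) :
    ∫ g, H ((g : E →L[ℝ] E) x) ((g : E →L[ℝ] E) y) ∂(orthogonalHaar E) =
      ∫ g, H ((g : E →L[ℝ] E) x') ((g : E →L[ℝ] E) y') ∂(orthogonalHaar E) := by
  obtain ⟨k, hk, hk'⟩ := exists_unitary_apply_eq hx hy hxy hx' hy' hxy'
  -- Right translation is a measurable equivalence, so `H` needs no regularity.
  rw [← integral_mul_right_eq_self _ k]
  simp [hk, hk']

theorem integral_orthogonalHaar_apply_eq {x x' : E} (hE : 2 ≤ Module.finrank ℝ E)
    (hx : ‖x‖ = 1) (hx' : ‖x'‖ = 1) (H : E → ℝ) :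
    ∫ g, H ((g : E →L[ℝ] E) x) ∂(orthogonalHaar E) =
      ∫ g, H ((g : E →L[ℝ] E) x') ∂(orthogonalHaar E) := by
  obtain ⟨k, hk⟩ := exists_unitary_apply_eq_of_norm_eq_one hE hx hx'
  rw [← integral_mul_right_eq_self _ k]
  simp [hk]

theorem continuous_unitary_apply {X : Type*} [TopologicalSpace X]
    {g : X → unitary (E →L[ℝ] E)} {x : X → E} (hg : Continuous g) (hx : Continuous x) :
    Continuous fun p => (g p : E →L[ℝ] E) (x p) :=
  (continuous_subtype_val.comp hg).clm_apply hx

theorem integrable_orthogonalHaar {f : unitary (E →L[ℝ] E) → ℝ} (hf : Continuous f) :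
    Integrable f (orthogonalHaar E) := by
  exact hf.integrable_of_hasCompactSupport (HasCompactSupport.of_compactSpace f)

end OrthogonalGroup

/-! ### Rotations of the sphere and invariance of the surface measure. -/

section Sphere

variable {n : ℕ}

local notation "𝔼" => EuclideanSpace ℝ (Fin (n + 1))

/-- The action of the orthogonal group on the sphere. -/
def sphereRotate (g : unitary (𝔼 →L[ℝ] 𝔼)) (σ : SphereS n) : SphereS n :=
  ⟨(g : 𝔼 →L[ℝ] 𝔼) σ, by rw [mem_sphere_zero_iff_norm, Unitary.norm_map]; simp⟩

@[simp]
theorem coe_sphereRotate (g : unitary (𝔼 →L[ℝ] 𝔼)) (σ : SphereS n) :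
    (sphereRotate g σ : 𝔼) = (g : 𝔼 →L[ℝ] 𝔼) σ := rfl

theorem continuous_sphereRotate {X : Type*} [TopologicalSpace X]
    {g : X → unitary (𝔼 →L[ℝ] 𝔼)} {σ : X → SphereS n} (hg : Continuous g) (hσ : Continuous σ) :
    Continuous fun p => sphereRotate (g p) (σ p) :=
  (continuous_unitary_apply hg (continuous_subtype_val.comp hσ)).subtype_mk _

theorem sdot_sphereRotate (g : unitary (𝔼 →L[ℝ] 𝔼)) (σ σ' : SphereS n) :
    sdot (sphereRotate g σ) (sphereRotate g σ') = sdot σ σ' :=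
  Unitary.inner_map_map g _ _

theorem sdot_comm (σ σ' : SphereS n) : sdot σ σ' = sdot σ' σ := real_inner_comm _ _

theorem continuous_sdot : Continuous fun p : SphereS n × SphereS n => sdot p.1 p.2 := by
  unfold sdot; fun_prop

instance : IsFiniteMeasure (surfaceMeasure n) := by
  unfold surfaceMeasure; infer_instance

-- The surface measure is a multiple of the volume of the cone over a set, and a linear isometry
-- preserves volume and carries cones to cones.
open scoped Pointwise in
theorem measurePreserving_sphereRotate (g : unitary (𝔼 →L[ℝ] 𝔼)) :
    MeasurePreserving (sphereRotate g) (surfaceMeasure n) (surfaceMeasure n) := by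
  have hm : Measurable (sphereRotate g) :=
    (continuous_sphereRotate continuous_const continuous_id).measurable
  refine ⟨hm, Measure.ext fun s hs => ?_⟩
  rw [Measure.map_apply hm hs, surfaceMeasure, Measure.toSphere_apply' _ hs,
    Measure.toSphere_apply' _ (hm hs)]
  congr 1
  set e := Unitary.linearIsometryEquiv g with he
  have hmp := e.measurePreserving
  rw [← hmp.measure_preimage_equiv (f := e.toMeasurableEquiv)
    (Set.Ioo (0 : ℝ) 1 • (Subtype.val '' s))]
  congr 1
  ext x
  simp only [Set.mem_smul, Set.mem_image, Set.mem_preimage]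
  constructor
  · rintro ⟨r, hr, -, ⟨σ, hσ, rfl⟩, rfl⟩
    refine ⟨r, hr, _, ⟨_, hσ, rfl⟩, ?_⟩
    change _ = e (r • (σ : 𝔼))
    rw [map_smul]
    rfl
  · rintro ⟨r, hr, -, ⟨σ, hσ, rfl⟩, h⟩
    change r • (σ : 𝔼) = e x at h
    refine ⟨r, hr, e.symm σ, ⟨⟨e.symm σ, by simp⟩, ?_, rfl⟩, ?_⟩
    · convert hσ
      apply Subtype.ext
      exact e.apply_symm_apply _
    · apply e.injective
      rw [map_smul, e.apply_symm_apply, h]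

theorem measurePreserving_prod_sphereRotate (g : unitary (𝔼 →L[ℝ] 𝔼)) :
    MeasurePreserving (Prod.map (sphereRotate g) (sphereRotate g))
      ((surfaceMeasure n).prod (surfaceMeasure n)) ((surfaceMeasure n).prod (surfaceMeasure n)) :=
  (measurePreserving_sphereRotate g).prod (measurePreserving_sphereRotate g)

theorem exists_sphereRotate_eq (hn : 1 ≤ n) (σ σ' : SphereS n) :
    ∃ g : unitary (𝔼 →L[ℝ] 𝔼), sphereRotate g σ = σ' := by
  obtain ⟨g, hg⟩ := exists_unitary_apply_eq_of_norm_eq_one (E := 𝔼) (by simp; omega)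
    (norm_eq_of_mem_sphere σ) (norm_eq_of_mem_sphere σ')
  exact ⟨g, Subtype.ext hg⟩

end Sphere

/-! ### Smoothness and gradient of the radial extension. -/

section RadialExtension

variable {n : ℕ} {F : SphereS n → ℝ}

local notation "𝔼" => EuclideanSpace ℝ (Fin (n + 1))

theorem radialExtension_coe (F : SphereS n → ℝ) (σ : SphereS n) :
    radialExtension F (σ : 𝔼) = F σ := by
  rw [radialExtension, norm_eq_of_mem_sphere σ, inv_one, one_smul,
    Subtype.val_injective.extend_apply]

theorem radialExtension_smul (F : SphereS n → ℝ) {c : ℝ} (hc : 0 < c) (x : 𝔼) :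
    radialExtension F (c • x) = radialExtension F x := by
  unfold radialExtension
  rw [norm_smul, Real.norm_of_nonneg hc.le, smul_smul, mul_inv, mul_assoc, mul_comm ‖x‖⁻¹,
    ← mul_assoc, inv_mul_cancel₀ hc.ne', one_mul]

theorem radialExtension_neg (hF : ∀ σ, F (-σ) = F σ) {x : 𝔼} (hx : ‖x‖ = 1) :
    radialExtension F (-x) = radialExtension F x := by
  have h := radialExtension_coe F ⟨x, by simp [hx]⟩
  have h' := radialExtension_coe F (-⟨x, by simp [hx]⟩)
  rw [hF] at h'
  exact h'.trans h.symm

/-- Off the origin the extension is `F` composed with the smooth map `y ↦ y / |y|` into the sphere.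
-/
theorem contDiffAt_radialExtension (hF : ContMDiff (𝓡 n) 𝓘(ℝ, ℝ) ∞ F) {x : 𝔼} (hx : x ≠ 0) :
    ContDiffAt ℝ ∞ (radialExtension F) x := by
  let U : TopologicalSpace.Opens 𝔼 := ⟨{0}ᶜ, isOpen_compl_singleton⟩
  have hmem : ∀ y : U, ‖(y : 𝔼)‖⁻¹ • (y : 𝔼) ∈ Metric.sphere (0 : 𝔼) 1 := fun y => by
    rw [mem_sphere_zero_iff_norm]
    exact norm_smul_inv_norm (𝕜 := ℝ) y.2
  have hν : ContMDiff 𝓘(ℝ, 𝔼) 𝓘(ℝ, 𝔼) ∞ fun y : U => ‖(y : 𝔼)‖⁻¹ • (y : 𝔼) := fun y => by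
    refine contMDiffAt_subtype_iff (f := fun y : 𝔼 => ‖y‖⁻¹ • y).2 ?_
    have hy : (y : 𝔼) ≠ 0 := y.2
    exact (((contDiffAt_id.norm ℝ hy).inv (norm_ne_zero_iff.2 hy)).smul
      contDiffAt_id).contMDiffAt
  have : Fact (Module.finrank ℝ 𝔼 = n + 1) := ⟨finrank_euclideanSpace_fin⟩
  have hcomp := hF.comp (hν.codRestrict_sphere hmem)
  have heq : F ∘ Set.codRestrict _ _ hmem = fun y : U => radialExtension F (y : 𝔼) := by
    funext y
    rw [Function.comp_apply, ← radialExtension_coe F]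
    exact radialExtension_smul F (inv_pos.2 (norm_pos_iff.2 y.2)) _
  rw [heq] at hcomp
  exact (contMDiffAt_subtype_iff.1 (hcomp (⟨x, hx⟩ : U))).contDiffAt

theorem continuousOn_radialExtension (hF : ContMDiff (𝓡 n) 𝓘(ℝ, ℝ) ∞ F) :
    ContinuousOn (radialExtension F) {0}ᶜ := fun _ hx =>
  (contDiffAt_radialExtension hF hx).continuousAt.continuousWithinAt

theorem continuousOn_gradient_radialExtension (hF : ContMDiff (𝓡 n) 𝓘(ℝ, ℝ) ∞ F) :
    ContinuousOn (gradient (radialExtension F)) {0}ᶜ := fun _ hx =>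
  ((InnerProductSpace.toDual ℝ 𝔼).symm.continuous.continuousAt.comp
    ((contDiffAt_radialExtension hF hx).continuousAt_fderiv (by simp))).continuousWithinAt

theorem hasGradientAt_radialExtension (hF : ContMDiff (𝓡 n) 𝓘(ℝ, ℝ) ∞ F) {x : 𝔼} (hx : x ≠ 0) :
    HasGradientAt (radialExtension F) (gradient (radialExtension F) x) x :=
  ((contDiffAt_radialExtension hF hx).differentiableAt (by simp)).hasGradientAt

theorem hasDerivAt_radialExtension_comp (hF : ContMDiff (𝓡 n) 𝓘(ℝ, ℝ) ∞ F) {γ : ℝ → 𝔼} {v : 𝔼}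
    {t : ℝ} (hγ : HasDerivAt γ v t) (h0 : γ t ≠ 0) :
    HasDerivAt (fun s => radialExtension F (γ s))
      (inner ℝ (gradient (radialExtension F) (γ t)) v) t := by
  have := (hasGradientAt_radialExtension hF h0).hasFDerivAt.comp_hasDerivAt t hγ
  rw [InnerProductSpace.toDual_apply_apply] at this
  exact this

/-- Euler's relation in degree zero: the extension is constant along rays. -/
theorem inner_gradient_radialExtension_self (hF : ContMDiff (𝓡 n) 𝓘(ℝ, ℝ) ∞ F) {x : 𝔼}
    (hx : x ≠ 0) : inner ℝ (gradient (radialExtension F) x) x = 0 := by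
  have h1 : HasDerivAt (fun s : ℝ => s • x) x 1 := by
    simpa using (hasDerivAt_id (1 : ℝ)).smul_const x
  have h2 := hasDerivAt_radialExtension_comp hF h1 (by simpa using hx)
  rw [one_smul] at h2
  have h3 : HasDerivAt (fun s : ℝ => radialExtension F (s • x)) 0 1 := by
    refine (hasDerivAt_const (1 : ℝ) (radialExtension F x)).congr_of_eventuallyEq ?_
    filter_upwards [lt_mem_nhds (zero_lt_one : (0 : ℝ) < 1)] with s hs
    exact radialExtension_smul F hs x
  exact h2.unique h3

theorem continuous_norm_sq_sphericalGradient (hF : ContMDiff (𝓡 n) 𝓘(ℝ, ℝ) ∞ F) :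
    Continuous fun σ => ‖sphericalGradient F σ‖ ^ 2 :=
  ((continuousOn_gradient_radialExtension hF).comp_continuous continuous_subtype_val
    fun σ => ne_zero_of_mem_unit_sphere σ).norm.pow 2

end RadialExtension

/-! ### Great circles and their moving frames; Fubini on an interval times a compact space. -/

section GreatCircle

variable {E : Type*} [NormedAddCommGroup E] [InnerProductSpace ℝ E]

theorem norm_cos_smul_add_sin_smul {x y : E} (hx : ‖x‖ = 1) (hy : ‖y‖ = 1)
    (hxy : inner ℝ x y = 0) (t : ℝ) : ‖Real.cos t • x + Real.sin t • y‖ = 1 := by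
  rw [← sq_eq_sq₀ (norm_nonneg _) zero_le_one, ← real_inner_self_eq_norm_sq]
  simp only [inner_add_left, inner_add_right, inner_smul_left, inner_smul_right,
    real_inner_self_eq_norm_sq, hx, hy, hxy, real_inner_comm x y]
  simp
  linarith [Real.sin_sq_add_cos_sq t]

theorem norm_neg_sin_smul_add_cos_smul {x y : E} (hx : ‖x‖ = 1) (hy : ‖y‖ = 1)
    (hxy : inner ℝ x y = 0) (t : ℝ) : ‖-Real.sin t • x + Real.cos t • y‖ = 1 := by
  have := norm_cos_smul_add_sin_smul hx hy hxy (t + Real.pi / 2)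
  rwa [Real.cos_add_pi_div_two, Real.sin_add_pi_div_two] at this

theorem inner_greatCircle_frame {x y : E} (hx : ‖x‖ = 1) (hy : ‖y‖ = 1)
    (hxy : inner ℝ x y = 0) (t : ℝ) :
    inner ℝ (Real.cos t • x + Real.sin t • y) (-Real.sin t • x + Real.cos t • y) = 0 := by
  simp only [inner_add_left, inner_add_right, inner_smul_left, inner_smul_right,
    real_inner_self_eq_norm_sq, hx, hy, hxy, real_inner_comm x y]
  simp
  ring

theorem hasDerivAt_cos_smul_add_sin_smul (x y : E) (t : ℝ) :
    HasDerivAt (fun t => Real.cos t • x + Real.sin t • y) (-Real.sin t • x + Real.cos t • y) t :=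
  ((Real.hasDerivAt_cos t).smul_const x).add ((Real.hasDerivAt_sin t).smul_const y)

theorem intervalIntegral_integral_swap_of_continuous {G : Type*} [TopologicalSpace G]
    [CompactSpace G] [T2Space G] [SecondCountableTopology G] [MeasurableSpace G] [BorelSpace G]
    {μ : Measure G} [IsFiniteMeasure μ] {f : ℝ → G → ℝ} (hf : Continuous (Function.uncurry f))
    {a b : ℝ} (hab : a ≤ b) :
    ∫ t in a..b, ∫ g, f t g ∂μ = ∫ g, (∫ t in a..b, f t g) ∂μ := by
  simp only [intervalIntegral.integral_of_le hab]
  refine integral_integral_swap ?_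
  have h : IntegrableOn (Function.uncurry f) (Set.Icc a b ×ˢ Set.univ) (volume.prod μ) :=
    hf.continuousOn.integrableOn_compact (isCompact_Icc.prod isCompact_univ)
  have h' := h.mono_set (Set.prod_mono Set.Ioc_subset_Icc_self (Set.subset_univ Set.univ))
  rwa [IntegrableOn, ← Measure.prod_restrict, Measure.restrict_univ] at h'

theorem integrable_intervalIntegral_of_continuous {G : Type*} [TopologicalSpace G]
    [CompactSpace G] [SecondCountableTopology G] [MeasurableSpace G] [BorelSpace G]
    {μ : Measure G} [IsFiniteMeasure μ] {f : ℝ → G → ℝ} (hf : Continuous (Function.uncurry f))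
    {a b : ℝ} :
    Integrable (fun g => ∫ t in a..b, f t g) μ := by
  have : Continuous fun g => ∫ t in a..b, f t g :=
    intervalIntegral.continuous_parametric_intervalIntegral_of_continuous'
      (f := fun g t => f t g) (hf.comp continuous_swap) a b
  exact this.integrable_of_hasCompactSupport (HasCompactSupport.of_compactSpace _)

end GreatCircle

/-! ### Averages over rotated great circles. -/

section Average

variable {n : ℕ} {F : SphereS n → ℝ}

local notation "𝔼" => EuclideanSpace ℝ (Fin (n + 1))

/-- The frame `(c t, c' t)` is orthonormal for every `t`, so both rotation averages are unchanged
when `(x, y)` is replaced by it. Integrating in `t` over `[0, π]` and swapping the integrals leaves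
the circle inequality for each fixed `g`. -/
theorem integral_sq_sub_radialExtension_le (hF : ContMDiff (𝓡 n) 𝓘(ℝ, ℝ) ∞ F)
    (heven : ∀ σ, F (-σ) = F σ) {x y : 𝔼} (hx : ‖x‖ = 1) (hy : ‖y‖ = 1)
    (hxy : inner ℝ x y = 0) (θ : ℝ) :
    ∫ g, (radialExtension F ((g : 𝔼 →L[ℝ] 𝔼) (Real.cos θ • x + Real.sin θ • y)) -
        radialExtension F ((g : 𝔼 →L[ℝ] 𝔼) x)) ^ 2 ∂(orthogonalHaar 𝔼) ≤
      Real.sin θ ^ 2 * ∫ g, inner ℝ (gradient (radialExtension F) ((g : 𝔼 →L[ℝ] 𝔼) x))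
        ((g : 𝔼 →L[ℝ] 𝔼) y) ^ 2 ∂(orthogonalHaar 𝔼) := by
  set R := radialExtension F with hR
  let c : ℝ → 𝔼 := fun t => Real.cos t • x + Real.sin t • y
  let c' : ℝ → 𝔼 := fun t => -Real.sin t • x + Real.cos t • y
  have hc1 : ∀ t, ‖c t‖ = 1 := norm_cos_smul_add_sin_smul hx hy hxy
  have hc0 : ∀ (g : unitary (𝔼 →L[ℝ] 𝔼)) t, (g : 𝔼 →L[ℝ] 𝔼) (c t) ≠ 0 := fun g t => by
    rw [← norm_pos_iff, Unitary.norm_map, hc1]; exact one_pos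
  have hcc : Continuous c := by fun_prop
  have hcc' : Continuous c' := by fun_prop
  have hadd : ∀ t, c (t + θ) = Real.cos θ • c t + Real.sin θ • c' t := fun t => by
    simp only [c, c', Real.cos_add, Real.sin_add]
    module
  have hRc : Continuous fun p : ℝ × unitary (𝔼 →L[ℝ] 𝔼) => R ((p.2 : 𝔼 →L[ℝ] 𝔼) (c p.1)) :=
    (continuousOn_radialExtension hF).comp_continuous
      (continuous_unitary_apply continuous_snd (hcc.comp continuous_fst)) fun p => hc0 _ _
  have hGc : Continuous fun p : ℝ × unitary (𝔼 →L[ℝ] 𝔼) =>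
      inner ℝ (gradient R ((p.2 : 𝔼 →L[ℝ] 𝔼) (c p.1))) ((p.2 : 𝔼 →L[ℝ] 𝔼) (c' p.1)) :=
    ((continuousOn_gradient_radialExtension hF).comp_continuous
      (continuous_unitary_apply continuous_snd (hcc.comp continuous_fst)) fun p => hc0 _ _).inner
      (continuous_unitary_apply continuous_snd (hcc'.comp continuous_fst))
  have hf1 : Continuous (Function.uncurry fun (t : ℝ) (g : unitary (𝔼 →L[ℝ] 𝔼)) =>
      (R ((g : 𝔼 →L[ℝ] 𝔼) (c (t + θ))) - R ((g : 𝔼 →L[ℝ] 𝔼) (c t))) ^ 2) :=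
    ((hRc.comp (f := fun p : ℝ × unitary (𝔼 →L[ℝ] 𝔼) => (p.1 + θ, p.2))
      (by fun_prop)).sub hRc).pow 2
  have hf2 : Continuous (Function.uncurry fun (t : ℝ) (g : unitary (𝔼 →L[ℝ] 𝔼)) =>
      inner ℝ (gradient R ((g : 𝔼 →L[ℝ] 𝔼) (c t))) ((g : 𝔼 →L[ℝ] 𝔼) (c' t)) ^ 2) := hGc.pow 2
  have h1 : ∀ t, ∫ g, (R ((g : 𝔼 →L[ℝ] 𝔼) (c (t + θ))) - R ((g : 𝔼 →L[ℝ] 𝔼) (c t))) ^ 2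
      ∂(orthogonalHaar 𝔼) =
      ∫ g, (R ((g : 𝔼 →L[ℝ] 𝔼) (Real.cos θ • x + Real.sin θ • y)) -
        R ((g : 𝔼 →L[ℝ] 𝔼) x)) ^ 2 ∂(orthogonalHaar 𝔼) := fun t => by
    have := integral_orthogonalHaar_pair_eq (hc1 t) (norm_neg_sin_smul_add_cos_smul hx hy hxy t)
      (inner_greatCircle_frame hx hy hxy t) hx hy hxy
      fun u v => (R (Real.cos θ • u + Real.sin θ • v) - R u) ^ 2
    simp_rw [hadd, map_add, map_smul]
    exact this
  have h2 : ∀ t, ∫ g, inner ℝ (gradient R ((g : 𝔼 →L[ℝ] 𝔼) (c t))) ((g : 𝔼 →L[ℝ] 𝔼) (c' t)) ^ 2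
      ∂(orthogonalHaar 𝔼) =
      ∫ g, inner ℝ (gradient R ((g : 𝔼 →L[ℝ] 𝔼) x)) ((g : 𝔼 →L[ℝ] 𝔼) y) ^ 2
        ∂(orthogonalHaar 𝔼) := fun t =>
    integral_orthogonalHaar_pair_eq (hc1 t) (norm_neg_sin_smul_add_cos_smul hx hy hxy t)
      (inner_greatCircle_frame hx hy hxy t) hx hy hxy fun u v => inner ℝ (gradient R u) v ^ 2
  have s1 := intervalIntegral_integral_swap_of_continuous (μ := orthogonalHaar 𝔼) hf1
    Real.pi_pos.le
  have s2 := intervalIntegral_integral_swap_of_continuous (μ := orthogonalHaar 𝔼) hf2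
    Real.pi_pos.le
  simp_rw [h1] at s1
  simp_rw [h2] at s2
  rw [intervalIntegral.integral_const, sub_zero, smul_eq_mul] at s1 s2
  refine le_of_mul_le_mul_left ?_ Real.pi_pos
  rw [s1, mul_left_comm, s2, ← integral_const_mul]
  refine integral_mono (integrable_intervalIntegral_of_continuous hf1)
    ((integrable_intervalIntegral_of_continuous hf2).const_mul _) fun g => ?_
  have hd : ∀ t, HasDerivAt (fun t => (g : 𝔼 →L[ℝ] 𝔼) (c t)) ((g : 𝔼 →L[ℝ] 𝔼) (c' t)) t :=
    fun t => (g : 𝔼 →L[ℝ] 𝔼).hasFDerivAt.comp_hasDerivAt t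
      (hasDerivAt_cos_smul_add_sin_smul x y t)
  refine integral_sq_sub_comp_add_right_le (f := fun t => R ((g : 𝔼 →L[ℝ] 𝔼) (c t)))
    (f' := fun t => inner ℝ (gradient R ((g : 𝔼 →L[ℝ] 𝔼) (c t))) ((g : 𝔼 →L[ℝ] 𝔼) (c' t)))
    (fun t => ?_) (fun t => hasDerivAt_radialExtension_comp hF (hd t) (hc0 g t))
    (hGc.comp (f := fun t : ℝ => (t, g)) (by fun_prop)) θ
  -- Half a turn is the antipodal map, so evenness gives period `π`.
  have : c (t + Real.pi) = -c t := by
    simp only [c, Real.cos_add_pi, Real.sin_add_pi]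
    module
  simp only [this, map_neg]
  exact radialExtension_neg heven (by rw [Unitary.norm_map, hc1])

/-- Complete `x` to an orthonormal basis. The component of the gradient along `g x` is zero, and the
other `n` components have equal mean squares. -/
theorem integral_inner_gradient_sq_eq (hn : 1 ≤ n) (hF : ContMDiff (𝓡 n) 𝓘(ℝ, ℝ) ∞ F) {x y : 𝔼}
    (hx : ‖x‖ = 1) (hy : ‖y‖ = 1) (hxy : inner ℝ x y = 0) :
    ∫ g, inner ℝ (gradient (radialExtension F) ((g : 𝔼 →L[ℝ] 𝔼) x))
        ((g : 𝔼 →L[ℝ] 𝔼) y) ^ 2 ∂(orthogonalHaar 𝔼) =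
      1 / n * ∫ g, ‖gradient (radialExtension F) ((g : 𝔼 →L[ℝ] 𝔼) x)‖ ^ 2
        ∂(orthogonalHaar 𝔼) := by
  set R := radialExtension F with hR
  obtain ⟨k, hk⟩ := exists_unitary_apply_eq_of_norm_eq_one (E := 𝔼)
    (x := EuclideanSpace.basisFun (Fin (n + 1)) ℝ 0) (by simp; omega) (by simp) hx
  let B := (EuclideanSpace.basisFun (Fin (n + 1)) ℝ).map (Unitary.linearIsometryEquiv k)
  have hB0 : B 0 = x := by rw [OrthonormalBasis.map_apply]; exact hk
  have hc0 : ∀ g : unitary (𝔼 →L[ℝ] 𝔼), (g : 𝔼 →L[ℝ] 𝔼) x ≠ 0 := fun g => by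
    rw [← norm_pos_iff, Unitary.norm_map, hx]; exact one_pos
  have hgc : Continuous fun g : unitary (𝔼 →L[ℝ] 𝔼) => gradient R ((g : 𝔼 →L[ℝ] 𝔼) x) :=
    (continuousOn_gradient_radialExtension hF).comp_continuous
      (continuous_unitary_apply continuous_id continuous_const) hc0
  have hsum : ∀ g : unitary (𝔼 →L[ℝ] 𝔼), ‖gradient R ((g : 𝔼 →L[ℝ] 𝔼) x)‖ ^ 2 =
      ∑ i : Fin n, inner ℝ (gradient R ((g : 𝔼 →L[ℝ] 𝔼) x)) ((g : 𝔼 →L[ℝ] 𝔼) (B i.succ)) ^ 2 := by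
    intro g
    have h := (B.map (Unitary.linearIsometryEquiv g)).sum_sq_norm_inner_left
      (gradient R ((g : 𝔼 →L[ℝ] 𝔼) x))
    rw [← h, Fin.sum_univ_succ]
    have h0 : inner ℝ (gradient R ((g : 𝔼 →L[ℝ] 𝔼) x)) ((g : 𝔼 →L[ℝ] 𝔼) (B 0)) = 0 := by
      rw [hB0]; exact inner_gradient_radialExtension_self hF (hc0 g)
    have e : ∀ i, (B.map (Unitary.linearIsometryEquiv g)) i = (g : 𝔼 →L[ℝ] 𝔼) (B i) :=
      fun i => by rw [OrthonormalBasis.map_apply]; rfl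
    simp only [e, h0, Real.norm_eq_abs, sq_abs]
    simp
  simp_rw [hsum]
  have hint : ∀ i ∈ Finset.univ, Integrable (fun g : unitary (𝔼 →L[ℝ] 𝔼) =>
      inner ℝ (gradient R ((g : 𝔼 →L[ℝ] 𝔼) x)) ((g : 𝔼 →L[ℝ] 𝔼) (B (Fin.succ i))) ^ 2)
      (orthogonalHaar 𝔼) := fun i _ => integrable_orthogonalHaar
    ((hgc.inner (continuous_unitary_apply continuous_id continuous_const)).pow 2)
  rw [integral_finsetSum _ hint]
  have hn0 : (n : ℝ) ≠ 0 := by exact_mod_cast (by omega : n ≠ 0)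
  rw [Finset.sum_congr rfl fun i _ => integral_orthogonalHaar_pair_eq hx (B.norm_eq_one i.succ)
    (by rw [← hB0]; exact B.inner_eq_zero (Fin.succ_ne_zero i).symm) hx hy hxy
    fun u v => inner ℝ (gradient R u) v ^ 2]
  simp [hn0]

end Average

/-! ### From rotation averages to the Hardy-type inequality. -/

section Hardy

variable {n : ℕ} {F : SphereS n → ℝ}

local notation "𝔼" => EuclideanSpace ℝ (Fin (n + 1))

theorem neg_one_le_sdot (σ σ' : SphereS n) : -1 ≤ sdot σ σ' := by
  have := abs_real_inner_le_norm (σ : 𝔼) (σ' : 𝔼)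
  rw [norm_eq_of_mem_sphere, norm_eq_of_mem_sphere, one_mul] at this
  exact (abs_le.1 this).1

theorem sdot_le_one (σ σ' : SphereS n) : sdot σ σ' ≤ 1 := by
  have := abs_real_inner_le_norm (σ : 𝔼) (σ' : 𝔼)
  rw [norm_eq_of_mem_sphere, norm_eq_of_mem_sphere, one_mul] at this
  exact (abs_le.1 this).2

theorem eq_of_sdot_eq_one {σ σ' : SphereS n} (h : sdot σ σ' = 1) : σ = σ' :=
  Subtype.ext ((inner_eq_one_iff_of_norm_eq_one (𝕜 := ℝ) (norm_eq_of_mem_sphere σ)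
    (norm_eq_of_mem_sphere σ')).1 h)

theorem eq_neg_of_sdot_eq_neg_one {σ σ' : SphereS n} (h : sdot σ σ' = -1) : σ' = -σ := by
  rw [eq_comm, neg_eq_iff_eq_neg]
  have hneg : sdot σ (-σ') = -sdot σ σ' := inner_neg_right _ _
  exact eq_of_sdot_eq_one (by rw [hneg, h, neg_neg])

/-- The average of a function along a moving point is its mean over the sphere. -/
theorem integral_surfaceMeasure_eq (hn : 1 ≤ n) {φ : 𝔼 → ℝ} (hφ : ContinuousOn φ {0}ᶜ)
    {x : 𝔼} (hx : ‖x‖ = 1) :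
    ∫ σ, φ (σ : 𝔼) ∂(surfaceMeasure n) =
      (surfaceMeasure n).real Set.univ *
        ∫ g, φ ((g : 𝔼 →L[ℝ] 𝔼) x) ∂(orthogonalHaar 𝔼) := by
  have hc : Continuous fun p : unitary (𝔼 →L[ℝ] 𝔼) × SphereS n => φ (sphereRotate p.1 p.2 : 𝔼) :=
    hφ.comp_continuous
      (continuous_subtype_val.comp (continuous_sphereRotate continuous_fst continuous_snd))
      fun p => ne_zero_of_mem_unit_sphere _
  have hint : Integrable (Function.uncurry fun (g : unitary (𝔼 →L[ℝ] 𝔼)) (σ : SphereS n) =>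
      φ (sphereRotate g σ : 𝔼)) ((orthogonalHaar 𝔼).prod (surfaceMeasure n)) :=
    hc.integrable_of_hasCompactSupport (HasCompactSupport.of_compactSpace _)
  have hs := integral_integral_swap hint
  -- The double integral over `g` and `σ` is computed in both orders: for fixed `g` the rotation
  -- drops out, for fixed `σ` the average does not see the point.
  have h1 : ∀ g : unitary (𝔼 →L[ℝ] 𝔼), ∫ σ, φ (sphereRotate g σ : 𝔼) ∂(surfaceMeasure n) =
      ∫ σ, φ (σ : 𝔼) ∂(surfaceMeasure n) := fun g => by
    have hφm : Continuous fun σ : SphereS n => φ (σ : 𝔼) :=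
      hφ.comp_continuous continuous_subtype_val fun σ => ne_zero_of_mem_unit_sphere σ
    have hmp := measurePreserving_sphereRotate g
    have h := integral_map hmp.aemeasurable
      (hφm.aestronglyMeasurable (μ := Measure.map (sphereRotate g) (surfaceMeasure n)))
    rw [hmp.map_eq] at h
    exact h.symm
  have h2 : ∀ σ : SphereS n, ∫ g, φ (sphereRotate g σ : 𝔼) ∂(orthogonalHaar 𝔼) =
      ∫ g, φ ((g : 𝔼 →L[ℝ] 𝔼) x) ∂(orthogonalHaar 𝔼) := fun σ =>
    integral_orthogonalHaar_apply_eq (by simp; omega) (norm_eq_of_mem_sphere σ) hx φ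
  simp_rw [h1, h2] at hs
  simpa using hs

theorem integral_sphericalGradient_sq_eq (hn : 1 ≤ n) (hF : ContMDiff (𝓡 n) 𝓘(ℝ, ℝ) ∞ F)
    (σ : SphereS n) :
    ∫ σ', ‖sphericalGradient F σ'‖ ^ 2 ∂(surfaceMeasure n) =
      (surfaceMeasure n).real Set.univ *
        ∫ g, ‖sphericalGradient F (sphereRotate g σ)‖ ^ 2 ∂(orthogonalHaar 𝔼) :=
  integral_surfaceMeasure_eq hn (φ := fun x => ‖gradient (radialExtension F) x‖ ^ 2)
    ((continuousOn_gradient_radialExtension hF).norm.pow 2) (norm_eq_of_mem_sphere σ)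

/-- The mean over all rotations of the squared increment of an even function is controlled by its
Dirichlet energy. -/
theorem integral_sq_sub_sphereRotate_le (hn : 1 ≤ n) (hF : ContMDiff (𝓡 n) 𝓘(ℝ, ℝ) ∞ F)
    (heven : ∀ σ, F (-σ) = F σ) (σ σ' : SphereS n) :
    ∫ g, (F (sphereRotate g σ') - F (sphereRotate g σ)) ^ 2 ∂(orthogonalHaar 𝔼) ≤
      (1 - sdot σ σ' ^ 2) * (1 / n *
        ∫ g, ‖sphericalGradient F (sphereRotate g σ)‖ ^ 2 ∂(orthogonalHaar 𝔼)) := by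
  -- Equal or antipodal points span no plane; there both sides vanish, by evenness in the antipodal
  -- case. Otherwise Gram–Schmidt gives `y`, and `σ'` lies at angle `arccos c` on the circle through
  -- `σ` and `y`.
  rcases (sdot_le_one σ σ').eq_or_lt with h1 | h1
  · rw [eq_of_sdot_eq_one h1]
    simp [sdot]
  rcases (neg_one_le_sdot σ σ').eq_or_lt with h2 | h2
  · have hneg : ∀ g : unitary (𝔼 →L[ℝ] 𝔼), sphereRotate g (-σ) = -sphereRotate g σ := fun g =>
      Subtype.ext (map_neg (g : 𝔼 →L[ℝ] 𝔼) (σ : 𝔼))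
    rw [eq_neg_of_sdot_eq_neg_one h2.symm]
    simp [hneg, heven, sdot]
  set c := sdot σ σ' with hc
  have hpos : 0 < 1 - c ^ 2 := by nlinarith
  set s := √(1 - c ^ 2) with hs
  have hs0 : 0 < s := Real.sqrt_pos.2 hpos
  have hs2 : s ^ 2 = 1 - c ^ 2 := Real.sq_sqrt hpos.le
  let y : 𝔼 := s⁻¹ • ((σ' : 𝔼) - c • (σ : 𝔼))
  have hσ := norm_eq_of_mem_sphere σ
  have hσ' := norm_eq_of_mem_sphere σ'
  have hin : inner ℝ (σ : 𝔼) (σ' : 𝔼) = c := rfl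
  have hxy : inner ℝ (σ : 𝔼) y = 0 := by
    simp only [y, inner_smul_right, inner_sub_right, hin, real_inner_self_eq_norm_sq, hσ]
    ring
  have hy : ‖y‖ = 1 := by
    rw [norm_smul, norm_inv, Real.norm_of_nonneg hs0.le, inv_mul_eq_one₀ hs0.ne', eq_comm,
      ← sq_eq_sq₀ (norm_nonneg _) hs0.le, hs2, norm_sub_sq_real, inner_smul_right,
      real_inner_comm, hin, hσ', norm_smul, hσ, Real.norm_eq_abs, mul_one, sq_abs]
    ring
  have hdec : (σ' : 𝔼) = Real.cos (Real.arccos c) • (σ : 𝔼) + Real.sin (Real.arccos c) • y := by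
    rw [Real.cos_arccos h2.le h1.le, Real.sin_arccos, ← hs, smul_inv_smul₀ hs0.ne']
    abel
  have key := integral_sq_sub_radialExtension_le hF heven hσ hy hxy (Real.arccos c)
  rw [integral_inner_gradient_sq_eq hn hF hσ hy hxy, ← hdec, Real.sin_arccos, ← hs, hs2] at key
  simp_rw [← coe_sphereRotate, radialExtension_coe] at key
  exact key

theorem one_sub_sdot_sq_nonneg (σ σ' : SphereS n) : 0 ≤ 1 - sdot σ σ' ^ 2 := by
  nlinarith [neg_one_le_sdot σ σ', sdot_le_one σ σ']

theorem measurable_comp_sdot_right {β : Type*} [MeasurableSpace β] {f : ℝ → β}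
    (hf : Measurable f) (σ : SphereS n) : Measurable fun σ' : SphereS n => f (sdot σ' σ) :=
  hf.comp (continuous_sdot.comp
    (by fun_prop : Continuous fun σ' : SphereS n => (σ', σ))).measurable

/-- The integral of a zonal function does not depend on its pole. -/
theorem lintegral_sdot_eq (hn : 1 ≤ n) {f : ℝ → ENNReal} (hf : Measurable f) (σ τ : SphereS n) :
    ∫⁻ σ', f (sdot σ' σ) ∂(surfaceMeasure n) = ∫⁻ σ', f (sdot σ' τ) ∂(surfaceMeasure n) := by
  obtain ⟨g, rfl⟩ := exists_sphereRotate_eq hn σ τ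
  rw [← (measurePreserving_sphereRotate g).lintegral_comp
    (measurable_comp_sdot_right hf (sphereRotate g σ))]
  simp_rw [sdot_sphereRotate]

theorem measurable_comp_sdot_swap {β : Type*} [MeasurableSpace β] {f : ℝ → β} (hf : Measurable f) :
    Measurable fun p : SphereS n × SphereS n => f (sdot p.2 p.1) :=
  hf.comp (continuous_sdot.comp continuous_swap).measurable

/-- The Hardy-type inequality in terms of lower Lebesgue integrals. -/
theorem lintegral_sq_sub_mul_le (hn : 1 ≤ n) (hF : ContMDiff (𝓡 n) 𝓘(ℝ, ℝ) ∞ F)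
    (heven : ∀ σ, F (-σ) = F σ) {β : ℝ → ℝ} (hβ : Measurable β) (hβ0 : ∀ c, 0 ≤ β c)
    (τ : SphereS n) :
    ∫⁻ p : SphereS n × SphereS n, ENNReal.ofReal ((F p.2 - F p.1) ^ 2 * β (sdot p.2 p.1))
        ∂((surfaceMeasure n).prod (surfaceMeasure n)) ≤
      ENNReal.ofReal (1 / n * ∫ σ, ‖sphericalGradient F σ‖ ^ 2 ∂(surfaceMeasure n)) *
        ∫⁻ σ', ENNReal.ofReal ((1 - sdot σ' τ ^ 2) * β (sdot σ' τ)) ∂(surfaceMeasure n) := by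
  have hFc : Continuous F := hF.continuous
  set m := (surfaceMeasure n).prod (surfaceMeasure n) with hm
  set K := ∫ g, ‖sphericalGradient F (sphereRotate g τ)‖ ^ 2 ∂(orthogonalHaar 𝔼) with hK
  have hK0 : 0 ≤ K := integral_nonneg fun g => by positivity
  have hKσ : ∀ σ : SphereS n,
      ∫ g, ‖sphericalGradient F (sphereRotate g σ)‖ ^ 2 ∂(orthogonalHaar 𝔼) = K := fun σ =>
    integral_orthogonalHaar_apply_eq (by simp; omega) (norm_eq_of_mem_sphere σ)
      (norm_eq_of_mem_sphere τ) fun x => ‖gradient (radialExtension F) x‖ ^ 2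
  have hmeas : Measurable fun p : SphereS n × SphereS n =>
      ENNReal.ofReal ((F p.2 - F p.1) ^ 2 * β (sdot p.2 p.1)) :=
    (((by fun_prop : Continuous fun p : SphereS n × SphereS n =>
      (F p.2 - F p.1) ^ 2).measurable).mul (measurable_comp_sdot_swap hβ)).ennreal_ofReal
  -- Rotating both points changes neither the measure nor `β (sdot p.2 p.1)`, only the increment of
  -- `F`.
  have hrot : ∀ g : unitary (𝔼 →L[ℝ] 𝔼),
      ∫⁻ p, ENNReal.ofReal ((F p.2 - F p.1) ^ 2 * β (sdot p.2 p.1)) ∂m =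
        ∫⁻ p, ENNReal.ofReal (β (sdot p.2 p.1)) *
          ENNReal.ofReal ((F (sphereRotate g p.2) - F (sphereRotate g p.1)) ^ 2) ∂m := by
    intro g
    rw [← (measurePreserving_prod_sphereRotate g).lintegral_comp hmeas]
    refine lintegral_congr fun p => ?_
    simp only [Prod.map_fst, Prod.map_snd, sdot_sphereRotate]
    rw [mul_comm, ENNReal.ofReal_mul (hβ0 _)]
  have hcont : Continuous fun q : unitary (𝔼 →L[ℝ] 𝔼) × (SphereS n × SphereS n) =>
      (F (sphereRotate q.1 q.2.2) - F (sphereRotate q.1 q.2.1)) ^ 2 :=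
    ((hFc.comp (continuous_sphereRotate continuous_fst (by fun_prop))).sub
      (hFc.comp (continuous_sphereRotate continuous_fst (by fun_prop)))).pow 2
  have hpt : ∀ p : SphereS n × SphereS n,
      ∫⁻ g, ENNReal.ofReal (β (sdot p.2 p.1)) *
          ENNReal.ofReal ((F (sphereRotate g p.2) - F (sphereRotate g p.1)) ^ 2)
          ∂(orthogonalHaar 𝔼) ≤
        ENNReal.ofReal (1 / n * K) *
          ENNReal.ofReal ((1 - sdot p.2 p.1 ^ 2) * β (sdot p.2 p.1)) := by
    intro p
    have hcp : Continuous fun g : unitary (𝔼 →L[ℝ] 𝔼) =>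
        (F (sphereRotate g p.2) - F (sphereRotate g p.1)) ^ 2 :=
      hcont.comp (f := fun g => (g, p)) (by fun_prop)
    rw [lintegral_const_mul _ hcp.measurable.ennreal_ofReal,
      ← ofReal_integral_eq_lintegral_ofReal (integrable_orthogonalHaar hcp)
        (Filter.Eventually.of_forall fun g => sq_nonneg _),
      ← ENNReal.ofReal_mul (hβ0 _), ← ENNReal.ofReal_mul (by positivity)]
    refine ENNReal.ofReal_le_ofReal ?_
    have := integral_sq_sub_sphereRotate_le hn hF heven p.1 p.2
    rw [hKσ, sdot_comm] at this
    calc _ ≤ β (sdot p.2 p.1) * ((1 - sdot p.2 p.1 ^ 2) * (1 / n * K)) :=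
          mul_le_mul_of_nonneg_left this (hβ0 _)
      _ = _ := by ring
  have hLm : Measurable fun c : ℝ => ENNReal.ofReal ((1 - c ^ 2) * β c) := by fun_prop
  calc ∫⁻ p, ENNReal.ofReal ((F p.2 - F p.1) ^ 2 * β (sdot p.2 p.1)) ∂m
      = ∫⁻ _ : unitary (𝔼 →L[ℝ] 𝔼), (∫⁻ p, ENNReal.ofReal
          ((F p.2 - F p.1) ^ 2 * β (sdot p.2 p.1)) ∂m) ∂(orthogonalHaar 𝔼) := by simp
    _ = ∫⁻ g, (∫⁻ p, ENNReal.ofReal (β (sdot p.2 p.1)) *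
          ENNReal.ofReal ((F (sphereRotate g p.2) - F (sphereRotate g p.1)) ^ 2) ∂m)
          ∂(orthogonalHaar 𝔼) := lintegral_congr hrot
    _ = ∫⁻ p, (∫⁻ g, ENNReal.ofReal (β (sdot p.2 p.1)) *
          ENNReal.ofReal ((F (sphereRotate g p.2) - F (sphereRotate g p.1)) ^ 2)
          ∂(orthogonalHaar 𝔼)) ∂m :=
        lintegral_lintegral_swap
          (((measurable_comp_sdot_swap hβ).ennreal_ofReal.comp measurable_snd).mul
            hcont.measurable.ennreal_ofReal).aemeasurable
    _ ≤ ∫⁻ p, ENNReal.ofReal (1 / n * K) *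
          ENNReal.ofReal ((1 - sdot p.2 p.1 ^ 2) * β (sdot p.2 p.1)) ∂m := lintegral_mono hpt
    _ = ENNReal.ofReal (1 / n * K) * ∫⁻ σ, (∫⁻ σ', ENNReal.ofReal
          ((1 - sdot σ' σ ^ 2) * β (sdot σ' σ)) ∂(surfaceMeasure n)) ∂(surfaceMeasure n) := by
        rw [lintegral_const_mul _ (measurable_comp_sdot_swap hLm),
          lintegral_prod _ (measurable_comp_sdot_swap hLm).aemeasurable]
    _ = _ := by
        -- The inner integral is independent of `σ`, so the outer one yields the total mass, which
        -- turns the mean `K` into the integral of `|∇F|²`.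
        rw [lintegral_congr fun σ => lintegral_sdot_eq hn hLm σ τ, lintegral_const,
          integral_sphericalGradient_sq_eq hn hF τ, ← hK, mul_left_comm (1 / (n : ℝ)),
          ENNReal.ofReal_mul measureReal_nonneg, ofReal_measureReal]
        ring

end Hardy

theorem propositionp (n : ℕ) (hn : 1 ≤ n) (b : ℝ → ℝ) (hb_meas : Measurable b)
    (hb_nonneg : ∀ c ∈ Set.Ioo (-1 : ℝ) 1, 0 ≤ b c) (hb_levy : LevyCondition n b) :
    ∃ C_P : ℝ,
      (∀ σ : SphereS n,
        C_P = 1 / (n : ℝ) *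
          ∫ σ', (1 - sdot σ' σ ^ 2) * b (sdot σ' σ) ∂(surfaceMeasure n)) ∧
      ∀ F : SphereS n → ℝ, ContMDiff (𝓡 n) 𝓘(ℝ, ℝ) ∞ F → (∀ σ, F (-σ) = F σ) →
        Integrable (fun p : SphereS n × SphereS n =>
            (F p.2 - F p.1) ^ 2 * b (sdot p.2 p.1))
          ((surfaceMeasure n).prod (surfaceMeasure n)) ∧
        Integrable (fun σ => ‖sphericalGradient F σ‖ ^ 2) (surfaceMeasure n) ∧
        ∫ p : SphereS n × SphereS n, (F p.2 - F p.1) ^ 2 * b (sdot p.2 p.1)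
            ∂((surfaceMeasure n).prod (surfaceMeasure n))
          ≤ C_P * ∫ σ, ‖sphericalGradient F σ‖ ^ 2 ∂(surfaceMeasure n) := by
  -- The sign of `b` is known only inside `(-1, 1)`. Truncation changes no integrand: at `±1` the
  -- weight `1 - c²` vanishes, and so does the increment of `F`, at `-1` by evenness.
  set β : ℝ → ℝ := (Set.Ioo (-1 : ℝ) 1).indicator b with hβdef
  have hβ : Measurable β := hb_meas.indicator measurableSet_Ioo
  have hβ0 : ∀ c, 0 ≤ β c := Set.indicator_nonneg hb_nonneg
  have hcases : ∀ σ σ' : SphereS n,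
      sdot σ' σ = 1 ∨ sdot σ' σ = -1 ∨ b (sdot σ' σ) = β (sdot σ' σ) := by
    intro σ σ'
    rcases (sdot_le_one σ' σ).eq_or_lt with h1 | h1
    · exact .inl h1
    rcases (neg_one_le_sdot σ' σ).eq_or_lt with h2 | h2
    · exact .inr (.inl h2.symm)
    · exact .inr (.inr (Set.indicator_of_mem (show sdot σ' σ ∈ Set.Ioo (-1 : ℝ) 1 from ⟨h2, h1⟩)
        b).symm)
  have hlevy_eq : ∀ σ σ' : SphereS n, (1 - sdot σ' σ ^ 2) * b (sdot σ' σ) =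
      (1 - sdot σ' σ ^ 2) * β (sdot σ' σ) := by
    intro σ σ'
    rcases hcases σ σ' with h | h | h
    · simp [h]
    · simp [h]
    · rw [h]
  have hLm : Measurable fun c : ℝ => ENNReal.ofReal ((1 - c ^ 2) * β c) := by fun_prop
  let τ : SphereS n := ⟨EuclideanSpace.single 0 1, by simp⟩
  set L := ∫⁻ σ', ENNReal.ofReal ((1 - sdot σ' τ ^ 2) * β (sdot σ' τ)) ∂(surfaceMeasure n) with hL
  have hLtop : L < ⊤ := by
    have := hb_levy τ
    simp_rw [sdot_comm τ, hlevy_eq] at this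
    exact this
  have hLint : ∀ σ : SphereS n,
      ∫ σ', (1 - sdot σ' σ ^ 2) * b (sdot σ' σ) ∂(surfaceMeasure n) = L.toReal := by
    intro σ
    simp_rw [hlevy_eq]
    have hms : Measurable fun σ' : SphereS n => (1 - sdot σ' σ ^ 2) * β (sdot σ' σ) :=
      measurable_comp_sdot_right (by fun_prop : Measurable fun c : ℝ => (1 - c ^ 2) * β c) σ
    rw [integral_eq_lintegral_of_nonneg_ae (Filter.Eventually.of_forall fun σ' =>
      mul_nonneg (one_sub_sdot_sq_nonneg σ' σ) (hβ0 _)) hms.aestronglyMeasurable,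
      lintegral_sdot_eq hn hLm σ τ]
  refine ⟨1 / n * L.toReal, fun σ => by rw [hLint], fun F hF heven => ?_⟩
  have hF_eq : ∀ p : SphereS n × SphereS n, (F p.2 - F p.1) ^ 2 * b (sdot p.2 p.1) =
      (F p.2 - F p.1) ^ 2 * β (sdot p.2 p.1) := by
    intro p
    rcases hcases p.1 p.2 with h | h | h
    · simp [eq_of_sdot_eq_one h]
    · rw [eq_neg_of_sdot_eq_neg_one h, heven]
      simp
    · rw [h]
  simp_rw [hF_eq]
  have hle := lintegral_sq_sub_mul_le hn hF heven hβ hβ0 τ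
  rw [← hL] at hle
  have hFc : Continuous F := hF.continuous
  have hmeas : Measurable fun p : SphereS n × SphereS n =>
      (F p.2 - F p.1) ^ 2 * β (sdot p.2 p.1) :=
    ((by fun_prop : Continuous fun p : SphereS n × SphereS n =>
      (F p.2 - F p.1) ^ 2).measurable).mul (measurable_comp_sdot_swap hβ)
  have hnn : ∀ p : SphereS n × SphereS n, 0 ≤ (F p.2 - F p.1) ^ 2 * β (sdot p.2 p.1) :=
    fun p => mul_nonneg (sq_nonneg _) (hβ0 _)
  have htop := ENNReal.mul_lt_top (ENNReal.ofReal_lt_top (r := 1 / (n : ℝ) *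
    ∫ σ, ‖sphericalGradient F σ‖ ^ 2 ∂(surfaceMeasure n))) hLtop
  refine ⟨⟨hmeas.aestronglyMeasurable, ?_⟩, ?_, ?_⟩
  · rw [hasFiniteIntegral_iff_ofReal (Filter.Eventually.of_forall hnn)]
    exact hle.trans_lt htop
  · exact (continuous_norm_sq_sphericalGradient hF).integrable_of_hasCompactSupport
      (HasCompactSupport.of_compactSpace _)
  · rw [integral_eq_lintegral_of_nonneg_ae (Filter.Eventually.of_forall hnn)
      hmeas.aestronglyMeasurable]
    refine (ENNReal.toReal_mono htop.ne hle).trans_eq ?_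
    rw [ENNReal.toReal_mul, ENNReal.toReal_ofReal
      (mul_nonneg (by positivity) (integral_nonneg fun σ => by positivity))]
    ring
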